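/- Let $s$ be a positive integer or half-integer and let $n\in\{0,1,\dots,[3s]\}$, where $[t]$ denotes the integer part of $t$. Let the integer indices $k,k'$ run over the range $0\le k,k'\le n$ if $n\le 2s$, and over the range $n-2s\le k,k'\le 4s-n$ if $2s\le n\le [3s]$. Define the real square matrices $A^{(s,n)}$ and $D_0^{(n)}$ by $$A^{(s,n)}_{kk'}=(-1)^{2s-n}\sqrt{(4s-2k+1)(4s-2k'+1)}\begin{Bmatrix} s & s & 2s-k\\ s & 3s-n & 2s-k'\end{Bmatrix},\qquad (D_0^{(n)})_{kk'}=(-1)^k\delta_{kk'},$$ where $\{\cdots\}$ is the (Wigner) $6j$-symbol of $sl_2$. Then $$A^{(s,n)}D_0^{(n)}A^{(s,n)}=(-1)^n\,D_0^{(n)}A^{(s,n)}D_0^{(n)}.$$ -/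

import Mathlib

open scoped Nat

namespace SpinChain

/-- The triangle condition on three spins `a/2`, `b/2`, `c/2` (the arguments are the doubled spins):
the sum of the spins is an integer, and each spin is at most the sum of the other two. -/
def IsTriad (a b c : ℕ) : Prop :=
  Even (a + b + c) ∧ a ≤ b + c ∧ b ≤ a + c ∧ c ≤ a + b

instance (a b c : ℕ) : Decidable (IsTriad a b c) := by
  unfold IsTriad; infer_instance

/-- The triangle coefficient of the spins `j₁ = a/2`, `j₂ = b/2`, `j₃ = c/2`, that is
`√((j₁+j₂-j₃)! (j₁-j₂+j₃)! (-j₁+j₂+j₃)! / (j₁+j₂+j₃+1)!)`.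
It is only used when `IsTriad a b c` holds, so that no subtraction or division truncates. -/
noncomputable def triangleCoeff (a b c : ℕ) : ℝ :=
  √((((a + b - c) / 2)! * ((a + c - b) / 2)! * ((b + c - a) / 2)! : ℝ)
    / (((a + b + c) / 2 + 1)! : ℝ))

/-- The alternating sum `∑ t, (-1)^t (t+1)! / (∏ i, (t - αᵢ)! * ∏ j, (βⱼ - t)!)` of Racah's formula,
over all integers `t` for which the arguments of all the factorials are nonnegative. -/
noncomputable def racahSum (α₁ α₂ α₃ α₄ β₁ β₂ β₃ : ℕ) : ℝ :=
  ∑ t ∈ Finset.Icc (max (max α₁ α₂) (max α₃ α₄)) (min β₁ (min β₂ β₃)),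
    (-1 : ℝ) ^ t * ((t + 1)! : ℝ) /
      (((t - α₁)! * (t - α₂)! * (t - α₃)! * (t - α₄)! *
        (β₁ - t)! * (β₂ - t)! * (β₃ - t)! : ℕ) : ℝ)

/-- The Wigner 6j symbol of `sl₂` with first row `a/2`, `b/2`, `c/2` and second row
`d/2`, `e/2`, `f/2` (the arguments are the doubled spins), given by Racah's formula.
It is zero unless all four triads `(a,b,c)`, `(a,e,f)`, `(d,b,f)`, `(d,e,c)` satisfy the triangle
condition. -/
noncomputable def sixJ (a b c d e f : ℕ) : ℝ :=
  if IsTriad a b c ∧ IsTriad a e f ∧ IsTriad d b f ∧ IsTriad d e c then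
    triangleCoeff a b c * triangleCoeff a e f * triangleCoeff d b f * triangleCoeff d e c *
      racahSum ((a + b + c) / 2) ((a + e + f) / 2) ((d + b + f) / 2) ((d + e + c) / 2)
        ((a + b + d + e) / 2) ((b + c + e + f) / 2) ((c + a + f + d) / 2)
  else 0

/-- The index set of the matrices of level `n` for spin `s = twoS / 2`:
`0 ≤ k ≤ n` if `n ≤ 2s`, and `n - 2s ≤ k ≤ 4s - n` if `2s ≤ n ≤ [3s]`
(the two ranges agree for `n = 2s`). -/
def levelRange (twoS n : ℕ) : Finset ℕ :=
  if n ≤ twoS then Finset.Icc 0 n else Finset.Icc (n - twoS) (2 * twoS - n)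

/-- The matrix `A^{(s,n)}` for spin `s = twoS / 2`. Its entries are
`(-1)^(2s-n) √((4s-2k+1)(4s-2k'+1)) {s, s, 2s-k; s, 3s-n, 2s-k'}`. In the range of
`n ≤ [3s]` and of the indices no subtraction of natural numbers truncates. -/
noncomputable def matA (twoS n : ℕ) : Matrix (levelRange twoS n) (levelRange twoS n) ℝ :=
  Matrix.of fun k k' =>
    (-1 : ℝ) ^ ((twoS : ℤ) - (n : ℤ)) *
      √((2 * (twoS : ℝ) - 2 * ((k : ℕ) : ℝ) + 1) * (2 * (twoS : ℝ) - 2 * ((k' : ℕ) : ℝ) + 1)) *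
      sixJ twoS twoS (2 * (twoS - (k : ℕ))) twoS (3 * twoS - 2 * n) (2 * (twoS - (k' : ℕ)))

/-- The diagonal sign matrix `D₀^{(n)}`, with entries `(-1)^k δ_{kk'}`. -/
def matD₀ (twoS n : ℕ) : Matrix (levelRange twoS n) (levelRange twoS n) ℝ :=
  Matrix.diagonal fun k => (-1 : ℝ) ^ (k : ℕ)

end SpinChain

/-!
The identity is a case of Racah's sum rule for `6j`-symbols. Put `N = 2s`, `M = 2N - n` and
`j = N - k`. Then `A = (-1)^(N-n) W R W` with `W` diagonal (`sixJFactor`), `W² = G` rational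
(`racahWeight`), and `R j k` the alternating sum in Racah's formula (`racahFun`). After the signs are
collected, the claim is `R G D R = D R D` with `D` the diagonal of the signs `(-1)^j`
(`racahFun_sum_rule`). Both `R` and `G` are symmetric under the exchange of `N` and `M`, so the two
ranges of `n` are one case: one may take `N = d + L`, `M = 2d + L`, with `j` running over
`d, …, d + L`.

Up to scaling, `R` is the matrix of the change between the coupling schemes `(12)3` and `1(23)`, and
so it turns the diagonal Casimir matrix `Λ` with entries `j(j+1)` into a tridiagonal matrix `S`:
`R Λ = S R` (`racahFun_recurrence`, proved by a telescoping certificate). Two special features make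
the argument work. The diagonal part of `S` is `(C - Λ)/2` for a constant `C`, hence
`D S D = C - Λ - S`; and `G` symmetrizes `S`. From these, `X = R G D R` satisfies
`X Λ = (D S D) X` (`recurrence_conj`; entrywise the computation is a telescoping alternating sum),
and `D R D` evidently satisfies the same relation. Both matrices are symmetric, and a symmetric
solution of such a three-term recurrence is determined by one corner entry
(`eq_zero_of_recurrence`). At the corner `(d + L, d)` every `6j`-symbol involved is a single term, and
the identity becomes a terminating very-well-poised hypergeometric sum (`sum_wellPoised`).
-/

namespace SpinChain

/-! ### Racah's formula and the recurrence relation -/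

/-- The reciprocal `1 / m!` of the factorial of an integer, equal to `0` for negative `m`. With this
convention all the summation ranges below can be enlarged at will. -/
noncomputable def invFact (m : ℤ) : ℝ :=
  if 0 ≤ m then ((m.toNat)! : ℝ)⁻¹ else 0

lemma invFact_of_neg {m : ℤ} (hm : m < 0) : invFact m = 0 := by
  simp [invFact, hm]

lemma invFact_natCast (m : ℕ) : invFact m = ((m ! : ℕ) : ℝ)⁻¹ := by
  simp [invFact]

lemma invFact_eq {m : ℤ} {r : ℕ} (h : m = r) : invFact m = ((r ! : ℕ) : ℝ)⁻¹ := by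
  rw [h, invFact_natCast]

lemma invFact_sub_one (m : ℤ) : invFact (m - 1) = m * invFact m := by
  rcases lt_trichotomy m 0 with h | rfl | h
  · rw [invFact_of_neg h, invFact_of_neg (by omega), mul_zero]
  · rw [invFact_of_neg (by omega)]; simp
  · obtain ⟨r, rfl⟩ : ∃ r : ℕ, m = r + 1 := ⟨(m - 1).toNat, by omega⟩
    rw [add_sub_cancel_right, invFact_natCast, show ((r : ℤ) + 1) = ((r + 1 : ℕ) : ℤ) by push_cast; ring,
      invFact_natCast, Nat.factorial_succ]
    push_cast
    have h1 : (r : ℝ) + 1 ≠ 0 := by positivity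
    have h2 : ((r ! : ℕ) : ℝ) ≠ 0 := by positivity
    field_simp

lemma invFact_eq_mul {m m' : ℤ} (h : m' = m + 1) : invFact m = (m + 1) * invFact m' := by
  subst h
  rw [← add_sub_cancel_right m 1, invFact_sub_one]
  push_cast
  ring_nf

/-- The summand of Racah's formula for the `6j`-symbol `{N/2, N/2, j; N/2, M - N/2, k}`. -/
noncomputable def racahTerm (N M : ℕ) (j k : ℤ) (t : ℕ) : ℝ :=
  (-1) ^ t * ((t + 1)! : ℝ) * invFact (t - N - j) * invFact (t - M - k) * invFact (t - N - k) *
    invFact (t - M - j) * invFact (N + M - t) * invFact (j + k + M - t) * invFact (j + k + N - t)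

/-- The sum in Racah's formula for the `6j`-symbol `{N/2, N/2, j; N/2, M - N/2, k}`. The parameters
`N` and `M` enter symmetrically. -/
noncomputable def racahFun (N M : ℕ) (j k : ℤ) : ℝ :=
  ∑ t ∈ Finset.range (N + M + 1), racahTerm N M j k t

lemma racahFun_comm (N M : ℕ) (j k : ℤ) : racahFun N M j k = racahFun N M k j := by
  refine Finset.sum_congr rfl fun t _ => ?_
  rw [racahTerm, racahTerm, add_comm k j]
  ring

lemma racahFun_swap (N M : ℕ) (j k : ℤ) : racahFun N M j k = racahFun M N j k := by
  rw [racahFun, racahFun, add_comm N M]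
  refine Finset.sum_congr rfl fun t _ => ?_
  rw [racahTerm, racahTerm, add_comm (N : ℤ) M]
  ring

/-- The polynomial factor of the telescoping certificate `racahCert`. -/
noncomputable def racahCertPoly (N M j k t : ℝ) : ℝ :=
  (-1 + j + 2*j*k - M - N - N*M) * t^2
    + (2 + 2*k - 4*j*k - 2*j*k^2 - 4*j^2 - 6*j^2*k + 3*M + 2*M*k + M*j - 2*M*j*k + M^2
      + 3*N + 2*N*k + N*j - 2*N*j*k + 4*N*M + 2*N*M*k + 2*N*M*j + N*M^2 + N^2 + N^2*M) * t
    + (-1 - 2*k - k^2 - 2*j - 2*j*k + 2*j^2 + 6*j^2*k + 3*j^2*k^2 + 3*j^3 + 4*j^3*k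
      - 2*M - 3*M*k - M*k^2 - 2*M*j + M*j*k^2 + M*j^2 + 3*M*j^2*k - M^2 - M^2*k + M^2*j*k
      - 2*N - 3*N*k - N*k^2 - 2*N*j + N*j*k^2 + N*j^2 + 3*N*j^2*k - 4*N*M - 4*N*M*k
      - N*M*k^2 - 5*N*M*j - 2*N*M*j*k - N*M*j^2 - 2*N*M^2 - N*M^2*k - N*M^2*j - N^2 - N^2*k
      + N^2*j*k - 2*N^2*M - N^2*M*k - N^2*M*j - N^2*M^2)

/-- The polynomial identity behind `racahTerm_recurrence`: what remains of it after division by the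
common hypergeometric factor. -/
lemma racahCertPoly_identity (N M j k t : ℝ) :
    j * (j + 1) * ((j + 1) ^ 2 - (N - M) ^ 2) *
        ((t - N - j) * (t - N - j + 1) * ((t - M - j) * (t - M - j + 1)))
      + ((N + 1) ^ 2 - j ^ 2) * ((M + 1) ^ 2 - j ^ 2) *
        ((j + k + M - t) * (j + k + M - t + 1) * ((j + k + N - t) * (j + k + N - t + 1)))
      + j * (2 * j + 1) *
          (N ^ 2 + M ^ 2 - N * M + N + M - j * (j + 1) - 2 * (k * (k + 1))) *
        ((t - N - j + 1) * (t - M - j + 1) * ((j + k + M - t + 1) * (j + k + N - t + 1)))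
      = -((t + 2) * (N + M - t) * ((j + k + M - t + 1) * (j + k + N - t + 1)) *
            racahCertPoly N M j k (t + 1))
        - (t - M - k) * (t - N - k) * ((t - N - j + 1) * (t - M - j + 1)) *
            racahCertPoly N M j k t := by
  unfold racahCertPoly
  ring1

/-- The telescoping certificate of the recurrence relation for `racahFun`, in the sense of
Zeilberger's algorithm: the combination of summands in the recurrence is its forward difference
in `t`. -/
noncomputable def racahCert (N M : ℕ) (j k : ℤ) (t : ℕ) : ℝ :=
  (-1) ^ t * ((t + 1)! : ℝ) * invFact (t - 1 - M - k) * invFact (t - 1 - N - k) *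
    invFact (N + M - t) * invFact (t - N - j) * invFact (t - M - j) *
    invFact (j + k + M - t + 1) * invFact (j + k + N - t + 1) * racahCertPoly N M j k t

lemma racahTerm_recurrence (N M : ℕ) (j k : ℤ) (t : ℕ) :
    (j * (j + 1) * ((j + 1) ^ 2 - (N - M) ^ 2)) * racahTerm N M (j + 1) k t
      + (((N + 1) ^ 2 - j ^ 2) * ((M + 1) ^ 2 - j ^ 2)) * racahTerm N M (j - 1) k t
      + (j * (2 * j + 1) *
          (N ^ 2 + M ^ 2 - N * M + N + M - j * (j + 1) - 2 * (k * (k + 1)))) * racahTerm N M j k t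
      = racahCert N M j k (t + 1) - racahCert N M j k t := by
  unfold racahTerm racahCert
  rw [Nat.factorial_succ (t + 1)]
  rw [show t - N - (j + 1) = t - N - j - 1 by ring, show t - M - (j + 1) = t - M - j - 1 by ring,
    show t - N - (j - 1) = t - N - j + 1 by ring, show t - M - (j - 1) = t - M - j + 1 by ring,
    show j + 1 + k + M - t = j + k + M - t + 1 by ring,
    show j + 1 + k + N - t = j + k + N - t + 1 by ring,
    show j - 1 + k + M - t = j + k + M - t - 1 by ring,
    show j - 1 + k + N - t = j + k + N - t - 1 by ring,
    show ((t + 1 : ℕ) : ℤ) - 1 - M - k = t - M - k by push_cast; ring,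
    show ((t + 1 : ℕ) : ℤ) - 1 - N - k = t - N - k by push_cast; ring,
    show ((t + 1 : ℕ) : ℤ) - N - j = t - N - j + 1 by push_cast; ring,
    show ((t + 1 : ℕ) : ℤ) - M - j = t - M - j + 1 by push_cast; ring,
    show (t : ℤ) - 1 - M - k = t - M - k - 1 by ring,
    show (t : ℤ) - 1 - N - k = t - N - k - 1 by ring,
    show (N : ℤ) + M - (t + 1 : ℕ) = N + M - t - 1 by push_cast; ring,
    show j + k + M - (t + 1 : ℕ) + 1 = j + k + M - t by push_cast; ring,
    show j + k + N - (t + 1 : ℕ) + 1 = j + k + N - t by push_cast; ring,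
    invFact_sub_one (t - N - j), invFact_sub_one (t - M - j), invFact_sub_one (t - N - k),
    invFact_sub_one (t - M - k), invFact_sub_one (N + M - t), invFact_sub_one (j + k + M - t),
    invFact_sub_one (j + k + N - t), invFact_eq_mul (m := t - N - j) rfl,
    invFact_eq_mul (m := t - M - j) rfl, invFact_eq_mul (m := j + k + M - t) rfl,
    invFact_eq_mul (m := j + k + N - t) rfl]
  generalize invFact (t - N - j + 1) = x1
  generalize invFact (t - M - j + 1) = x2
  generalize invFact (j + k + M - t + 1) = x3
  generalize invFact (j + k + N - t + 1) = x4
  generalize invFact (t - M - k) = x5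
  generalize invFact (t - N - k) = x6
  generalize invFact (N + M - t) = x7
  push_cast
  generalize ((t + 1)! : ℝ) = x8
  rw [pow_succ (-1 : ℝ) t]
  generalize (-1 : ℝ) ^ t = x9
  have hP := racahCertPoly_identity N M j k t
  generalize racahCertPoly N M j k t = H₀ at hP ⊢
  generalize racahCertPoly N M j k (t + 1) = H₁ at hP ⊢
  generalize (j * (j + 1) * ((j + 1) ^ 2 - (N - M) ^ 2) : ℝ) = c₁ at hP ⊢
  generalize (((N + 1) ^ 2 - j ^ 2) * ((M + 1) ^ 2 - j ^ 2) : ℝ) = c₂ at hP ⊢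
  generalize (j * (2 * j + 1) *
    (N ^ 2 + M ^ 2 - N * M + N + M - j * (j + 1) - 2 * (k * (k + 1))) : ℝ) = c₃ at hP ⊢
  generalize (t - N - j : ℝ) = p at hP ⊢
  generalize (t - M - j : ℝ) = q at hP ⊢
  generalize (j + k + M - t : ℝ) = u at hP ⊢
  generalize (j + k + N - t : ℝ) = v at hP ⊢
  generalize (t - M - k : ℝ) = y at hP ⊢
  generalize (t - N - k : ℝ) = z at hP ⊢
  linear_combination (x1 * x2 * x3 * x4 * x5 * x6 * x7 * x8 * x9) * hP

/-- The three-term recurrence relation of the `6j`-symbols, cleared of denominators. -/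
lemma racahFun_recurrence_mul (N M : ℕ) (j k : ℤ) (hk : 0 ≤ k) :
    (j * (j + 1) * ((j + 1) ^ 2 - (N - M) ^ 2)) * racahFun N M (j + 1) k
      + (((N + 1) ^ 2 - j ^ 2) * ((M + 1) ^ 2 - j ^ 2)) * racahFun N M (j - 1) k
      + (j * (2 * j + 1) *
          (N ^ 2 + M ^ 2 - N * M + N + M - j * (j + 1) - 2 * (k * (k + 1)))) * racahFun N M j k
      = 0 := by
  have h0 : racahCert N M j k 0 = 0 := by
    rw [racahCert, invFact_of_neg (m := ((0 : ℕ) : ℤ) - 1 - M - k) (by push_cast; omega)]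
    ring
  have h1 : racahCert N M j k (N + M + 1) = 0 := by
    rw [racahCert, invFact_of_neg (m := N + M - ((N + M + 1 : ℕ) : ℤ)) (by push_cast; omega)]
    ring
  simp only [racahFun, Finset.mul_sum]
  rw [← Finset.sum_add_distrib, ← Finset.sum_add_distrib,
    Finset.sum_congr rfl fun t _ => racahTerm_recurrence N M j k t, Finset.sum_range_sub, h0, h1,
    sub_zero]

/-! ### Kernels satisfying a tridiagonal recurrence -/

section Recurrence

variable {L : ℕ} {a b e lam G σ : ℤ → ℝ} {R : ℤ → ℤ → ℝ} {C : ℝ}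

/-- If the symmetric kernel `R` intertwines a tridiagonal operator with coefficients `a`, `e`, `b`
with the diagonal operator `lam`, where `lam + 2 e` is constant and `G` symmetrizes the tridiagonal
operator, then `R G D R`, with `D` the diagonal of alternating signs `σ`, satisfies the same
recurrence with the signs of `a` and `b` reversed. -/
lemma recurrence_conj
    (hrec : ∀ j k : ℤ, 0 ≤ j → j ≤ L → 0 ≤ k → k ≤ L →
      a j * R (j + 1) k + e j * R j k + b j * R (j - 1) k = lam k * R j k)
    (hC : ∀ j, lam j + 2 * e j = C)
    (hsymm : ∀ j k, R j k = R k j)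
    (h0 : ∀ k : ℤ, 0 ≤ k → k ≤ L → R (-1) k = 0)
    (hL : ∀ k : ℤ, 0 ≤ k → k ≤ L → R (L + 1) k = 0)
    (hbal : ∀ j : ℤ, 0 ≤ j → j < L → G j * a j = G (j + 1) * b (j + 1))
    (hσ : ∀ j, σ (j + 1) = -σ j)
    (j k : ℤ) (hj0 : 0 ≤ j) (hjL : j ≤ L) (hk0 : 0 ≤ k) (hkL : k ≤ L) :
    -a j * (∑ i ∈ Finset.range (L + 1), σ i * G i * R (j + 1) i * R i k)
      + e j * (∑ i ∈ Finset.range (L + 1), σ i * G i * R j i * R i k)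
      - b j * (∑ i ∈ Finset.range (L + 1), σ i * G i * R (j - 1) i * R i k)
      = lam k * ∑ i ∈ Finset.range (L + 1), σ i * G i * R j i * R i k := by
  -- the symmetric expression whose alternating sums telescope
  let f : ℤ → ℝ := fun x => R x j * R (x + 1) k + R (x + 1) j * R x k
  -- the partial sums; the boundary value at `0` is set by hand, as `f (-1) = 0` while nothing is
  -- assumed about the coefficients at `-1`
  let W : ℕ → ℝ := fun i =>
    if i = 0 then 0 else σ ((i : ℤ) - 1) * G (i - 1) * a (i - 1) * f (i - 1)
  have hW : ∀ i ∈ Finset.range (L + 1),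
      -a j * (σ i * G i * R (j + 1) i * R i k) + e j * (σ i * G i * R j i * R i k)
        - b j * (σ i * G i * R (j - 1) i * R i k) - lam k * (σ i * G i * R j i * R i k)
        = -(W (i + 1) - W i) := by
    intro i hi
    have hiL : (i : ℤ) ≤ L := by have := Finset.mem_range.1 hi; omega
    have r1 := hrec j i hj0 hjL (by omega) hiL
    have r2 := hrec i k (by omega) hiL hk0 hkL
    have r3 := hrec i j (by omega) hiL hj0 hjL
    have hWs : W (i + 1) = σ i * G i * a i * f i := by
      simp [W]
    have hWi : W i = -(σ i * G i * b i * f (i - 1)) := by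
      rcases Nat.eq_zero_or_pos i with rfl | hpos
      · simp [W, f, h0 j hj0 hjL, h0 k hk0 hkL]
      · have hs := hσ ((i : ℤ) - 1)
        have hb := hbal ((i : ℤ) - 1) (by omega) (by omega)
        rw [sub_add_cancel] at hs hb
        simp only [W, if_neg hpos.ne']
        rw [hs]
        linear_combination σ ((i : ℤ) - 1) * f (i - 1) * hb
    rw [hWs, hWi]
    simp only [f, sub_add_cancel]
    have hCi := hC i
    have hCj := hC j
    rw [hsymm j i] at r1 ⊢
    linear_combination (-σ i * G i * R i k) * r1 + (σ i * G i * R i j) * r2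
      + (σ i * G i * R i k) * r3 + σ i * G i * R i k * R i j * (hCj - hCi)
  have hWL : W (L + 1) = 0 := by
    simp [W, f, hL j hj0 hjL, hL k hk0 hkL]
  have hW0 : W 0 = 0 := by simp [W]
  have := Finset.sum_congr rfl hW
  rw [Finset.sum_neg_distrib, Finset.sum_range_sub, hWL, hW0, sub_zero, neg_zero,
    Finset.sum_sub_distrib, Finset.sum_sub_distrib, Finset.sum_add_distrib] at this
  simp only [← Finset.mul_sum] at this
  linarith

/-- A symmetric solution of a three-term recurrence that vanishes at one corner vanishes
identically: the recurrence propagates the zero along the column of that corner, symmetry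
turns the column into a row, and the recurrence propagates from that row to all others. -/
lemma eq_zero_of_recurrence {Z : ℤ → ℤ → ℝ}
    (hrec : ∀ j k : ℤ, 0 ≤ j → j ≤ L → 0 ≤ k → k ≤ L →
      a j * Z (j + 1) k + e j * Z j k + b j * Z (j - 1) k = lam k * Z j k)
    (hsymm : ∀ j k, Z j k = Z k j)
    (h0 : ∀ k : ℤ, 0 ≤ k → k ≤ L → Z (-1) k = 0)
    (hL : ∀ k : ℤ, 0 ≤ k → k ≤ L → Z (L + 1) k = 0)
    (ha : ∀ j : ℤ, 0 ≤ j → j < L → a j ≠ 0) (hb : ∀ j : ℤ, 0 < j → j ≤ L → b j ≠ 0)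
    (hcorner : Z L 0 = 0) (j k : ℤ) (hj0 : 0 ≤ j) (hjL : j ≤ L) (hk0 : 0 ≤ k) (hkL : k ≤ L) :
    Z j k = 0 := by
  have down : ∀ m : ℕ, m ≤ L → Z (L - m) 0 = 0 ∧ Z (L - m + 1) 0 = 0 := by
    intro m
    induction m with
    | zero => intro _; simpa using ⟨hcorner, hL 0 le_rfl (by omega)⟩
    | succ m ih =>
      intro hm
      obtain ⟨h1, h2⟩ := ih (by omega)
      have r := hrec (L - m) 0 (by omega) (by omega) le_rfl (by omega)
      rw [h1, h2] at r
      have hz : Z (L - m - 1) 0 = 0 :=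
        (mul_eq_zero.1 (by linarith : b (L - m) * Z (L - m - 1) 0 = 0)).resolve_left
          (hb _ (by omega) (by omega))
      push_cast
      exact ⟨by rw [← sub_sub]; exact hz, by rw [← sub_sub, sub_add_cancel]; exact h1⟩
  have up : ∀ m : ℕ, m ≤ L → Z m k = 0 ∧ Z (m - 1) k = 0 := by
    intro m
    induction m with
    | zero =>
      intro _
      have h := (down (L - k).toNat (by omega)).1
      rw [show (L : ℤ) - (L - k).toNat = k by omega, hsymm] at h
      simpa using ⟨h, h0 k hk0 hkL⟩
    | succ m ih =>
      intro hm
      obtain ⟨h1, h2⟩ := ih (by omega)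
      have r := hrec m k (by omega) (by omega) hk0 hkL
      rw [h1, h2] at r
      have hz : Z (m + 1) k = 0 :=
        (mul_eq_zero.1 (by linarith : a m * Z (m + 1) k = 0)).resolve_left
          (ha _ (by omega) (by omega))
      push_cast
      exact ⟨hz, by rw [add_sub_cancel_right]; exact h1⟩
  have := (up j.toNat (by omega)).1
  rwa [Int.toNat_of_nonneg hj0] at this

end Recurrence

/-! ### A very-well-poised hypergeometric sum -/

/-- A terminating very-well-poised `₃F₂(-1)` sum. It follows by induction on `L`, the increment in
`L` being a telescoping sum (the Wilf–Zeilberger method). -/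
lemma sum_wellPoised (d L : ℕ) :
    ∑ i ∈ Finset.range (L + 1), (2 * d + 2 * i + 1 : ℝ) * ((2 * d + i)! : ℝ) *
      invFact (2 * d + L + i + 1) * invFact i * invFact (L - i) =
      (d ! : ℝ) * invFact L * invFact (d + L) := by
  induction L with
  | zero =>
    rw [Finset.sum_range_one, invFact_eq (r := 2 * d + 1) (by push_cast; ring),
      invFact_eq (r := 0) (by simp), invFact_eq (r := 0) (by simp), invFact_eq (r := d) (by simp),
      Nat.factorial_succ]
    have h1 : ((2 * d)! : ℝ) ≠ 0 := by positivity
    have h2 : (d ! : ℝ) ≠ 0 := by positivity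
    push_cast
    simp
    field_simp
  | succ L ih =>
    let V : ℕ → ℝ := fun i => -((d : ℝ) + i) * ((2 * d + i)! : ℝ) *
      invFact (2 * d + L + i + 1) * invFact (i - 1) * invFact (L + 1 - i)
    have step : ∀ i : ℕ, (L + 1 : ℝ) * (d + L + 1) * ((2 * d + 2 * i + 1 : ℝ) * ((2 * d + i)! : ℝ) *
        invFact (2 * d + (L + 1 : ℕ) + i + 1) * invFact i * invFact ((L + 1 : ℕ) - i)) -
        (2 * d + 2 * i + 1 : ℝ) * ((2 * d + i)! : ℝ) *
        invFact (2 * d + L + i + 1) * invFact i * invFact (L - i) = V (i + 1) - V i := by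
      intro i
      simp only [V]
      rw [invFact_eq_mul (m := 2 * d + L + i + 1) (m' := 2 * d + L + i + 2) (by ring),
        invFact_eq_mul (m := L - i) (m' := L + 1 - i) (by ring),
        invFact_eq_mul (m := (i : ℤ) - 1) (m' := i) (by ring),
        show ((2 : ℤ) * d + (L + 1 : ℕ) + i + 1) = 2 * d + L + i + 2 by push_cast; ring,
        show (((L + 1 : ℕ) : ℤ) - i) = L + 1 - i by push_cast; ring,
        show ((2 : ℤ) * d + L + (i + 1 : ℕ) + 1) = 2 * d + L + i + 2 by push_cast; ring,
        show (((i + 1 : ℕ) : ℤ) - 1) = i by push_cast; ring,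
        invFact_eq_mul (m := (L : ℤ) + 1 - (i + 1 : ℕ)) (m' := L + 1 - i) (by push_cast; ring),
        ← add_assoc (2 * d) i 1, Nat.factorial_succ]
      push_cast
      ring
    have tel := Finset.sum_range_sub V (L + 2)
    rw [← Finset.sum_congr rfl fun i _ => step i, Finset.sum_sub_distrib, ← Finset.mul_sum,
      Finset.sum_range_succ (fun i : ℕ => (2 * d + 2 * i + 1 : ℝ) * ((2 * d + i)! : ℝ) *
        invFact (2 * d + L + i + 1) * invFact i * invFact (L - i)) (L + 1), ih] at tel
    have hV0 : V 0 = 0 := by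
      simp [V, invFact_of_neg (m := -1) (by omega)]
    have hV1 : V (L + 2) = 0 := by
      simp only [V]
      rw [invFact_of_neg (m := (L : ℤ) + 1 - (L + 2 : ℕ)) (by push_cast; omega), mul_zero]
    rw [hV0, hV1, invFact_of_neg (m := (L : ℤ) - (L + 1 : ℕ)) (by push_cast; omega),
      invFact_eq_mul (m := (L : ℤ)) (m' := (L + 1 : ℕ)) (by push_cast; ring),
      invFact_eq_mul (m := (d + L : ℤ)) (m' := d + (L + 1 : ℕ)) (by push_cast; ring)] at tel
    have h1 : (L + 1 : ℝ) * (d + L + 1) ≠ 0 := by positivity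
    refine mul_left_cancel₀ h1 ?_
    push_cast at tel ⊢
    linear_combination tel

/-! ### Normalized recurrence, weight, and single-term values -/

lemma racahTerm_eq_zero {N M : ℕ} {j k : ℤ} {t : ℕ}
    (h : ¬ (N + j ≤ t ∧ M + k ≤ t ∧ N + k ≤ t ∧ M + j ≤ t ∧ (t : ℤ) ≤ N + M ∧ t ≤ j + k + M ∧
      t ≤ j + k + N)) : racahTerm N M j k t = 0 := by
  contrapose! h
  have key : ∀ m : ℤ, invFact m ≠ 0 → 0 ≤ m := fun m hm => by
    by_contra hneg
    exact hm (invFact_of_neg (by omega))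
  simp only [racahTerm, ne_eq, mul_eq_zero, not_or] at h
  obtain ⟨⟨⟨⟨⟨⟨⟨-, h1⟩, h2⟩, h3⟩, h4⟩, h5⟩, h6⟩, h7⟩ := h
  have := key _ h1
  have := key _ h2
  have := key _ h3
  have := key _ h4
  have := key _ h5
  have := key _ h6
  have := key _ h7
  omega

/-- When the bounds on `t` in Racah's formula meet, a single term remains. -/
lemma racahFun_eq_racahTerm {N M : ℕ} {j k : ℤ} (s : ℕ)
    (h : ∀ t : ℕ, t ≠ s → ¬ (N + j ≤ t ∧ M + k ≤ t ∧ N + k ≤ t ∧ M + j ≤ t ∧ (t : ℤ) ≤ N + M ∧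
      t ≤ j + k + M ∧ t ≤ j + k + N)) : racahFun N M j k = racahTerm N M j k s := by
  refine Finset.sum_eq_single s (fun t _ ht => racahTerm_eq_zero (h t ht)) fun hs => ?_
  refine racahTerm_eq_zero ?_
  have := mt Finset.mem_range.2 hs
  omega

/-- The recurrence relation at `j = 0`, where `racahFun_recurrence_mul` degenerates. -/
lemma racahFun_recurrence_zero (M k : ℕ) :
    racahFun M M 1 k / 2 + (M ^ 2 + 2 * M) / 2 * racahFun M M 0 k
      = k * (k + 1) * racahFun M M 0 k := by
  have h0 : racahFun M M 0 k = racahTerm M M 0 k (M + k) :=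
    racahFun_eq_racahTerm _ fun t ht => by omega
  have h1 : racahFun M M 1 k = racahTerm M M 1 k (M + k) + racahTerm M M 1 k (M + k + 1) := by
    refine Finset.sum_eq_add _ _ (by omega) (fun t _ ht => racahTerm_eq_zero (by omega))
      (fun hs => racahTerm_eq_zero ?_) (fun hs => racahTerm_eq_zero ?_)
    · have := mt Finset.mem_range.2 hs
      omega
    · have := mt Finset.mem_range.2 hs
      omega
  rw [h0, h1]
  have e0 : invFact 0 = 1 := by rw [invFact_eq (r := 0) (by simp)]; simp
  have e1 : invFact 1 = 1 := by rw [invFact_eq (r := 1) (by simp)]; simp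
  unfold racahTerm
  rw [Nat.factorial_succ (M + k + 1), pow_succ (-1 : ℝ) (M + k),
    show ((M + k : ℕ) : ℤ) - M - 0 = k by push_cast; ring,
    show ((M + k : ℕ) : ℤ) - M - k = 0 by push_cast; ring,
    show (M : ℤ) + M - (M + k : ℕ) = M - k by push_cast; ring,
    show (0 : ℤ) + k + M - (M + k : ℕ) = 0 by push_cast; ring,
    show (1 : ℤ) + k + M - (M + k : ℕ) = 1 by push_cast; ring,
    show ((M + k + 1 : ℕ) : ℤ) - M - 1 = k by push_cast; ring,
    show ((M + k + 1 : ℕ) : ℤ) - M - k = 1 by push_cast; ring,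
    show (1 : ℤ) + k + M - (M + k + 1 : ℕ) = 0 by push_cast; ring,
    invFact_eq_mul (m := ((M + k : ℕ) : ℤ) - M - 1) (m' := k) (by push_cast; ring),
    invFact_eq_mul (m := (M : ℤ) + M - (M + k + 1 : ℕ)) (m' := M - k) (by push_cast; ring), e0, e1]
  push_cast
  ring

/-- The three-term recurrence relation of the `6j`-symbols. At `j = 0` the coefficient of
`racahFun N M (j - 1) k` is zero by the convention on division. -/
lemma racahFun_recurrence (N M : ℕ) (j k : ℤ) (hj : 0 ≤ j) (hk : 0 ≤ k) (hNM : j = 0 → N = M) :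
    (j + 1) * ((j + 1) ^ 2 - (N - M) ^ 2) / (2 * (2 * j + 1)) * racahFun N M (j + 1) k
      + (N ^ 2 + M ^ 2 - N * M + N + M - j * (j + 1)) / 2 * racahFun N M j k
      + ((N + 1) ^ 2 - j ^ 2) * ((M + 1) ^ 2 - j ^ 2) / (2 * j * (2 * j + 1)) *
        racahFun N M (j - 1) k
      = k * (k + 1) * racahFun N M j k := by
  rcases hj.eq_or_lt with rfl | hpos
  · obtain rfl := hNM rfl
    lift k to ℕ using hk
    have h := racahFun_recurrence_zero N k
    push_cast
    rw [zero_add]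
    simp only [mul_zero, zero_mul, div_zero, add_zero]
    linear_combination h
  · have hj' : (0 : ℝ) < j := by exact_mod_cast hpos
    have h := racahFun_recurrence_mul N M j k hk
    have h1 : (j : ℝ) ≠ 0 := hj'.ne'
    have h2 : (2 * (j : ℝ) + 1) ≠ 0 := by positivity
    field_simp
    linear_combination h

/-- The weight `(2 x + 1) Δ(N/2, N/2, x)² Δ(N/2, M - N/2, x)²`, where `Δ` is the triangle
coefficient. -/
noncomputable def racahWeight (N M x : ℕ) : ℝ :=
  (2 * x + 1) * (((N - x)! * x ! * x ! : ℝ) / ((N + x + 1)! : ℝ)) *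
    (((M - x)! * (N + x - M)! * (M + x - N)! : ℝ) / ((M + x + 1)! : ℝ))

lemma racahWeight_swap (N M x : ℕ) : racahWeight N M x = racahWeight M N x := by
  unfold racahWeight
  ring

/-- The weight makes the tridiagonal operator of `racahFun_recurrence` symmetric. -/
lemma racahWeight_balance (d L i : ℕ) (hi : i < L) :
    racahWeight (d + L) (2 * d + L) (d + i) *
        ((d + i + 1) * ((d + i + 1) ^ 2 - d ^ 2) / (2 * (2 * (d + i) + 1)))
      = racahWeight (d + L) (2 * d + L) (d + i + 1) *
        (((d + L + 1) ^ 2 - (d + i + 1) ^ 2) * ((2 * d + L + 1) ^ 2 - (d + i + 1) ^ 2) /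
          (2 * (d + i + 1) * (2 * (d + i + 1) + 1))) := by
  obtain ⟨r, rfl⟩ : ∃ r, L = i + r + 1 := ⟨L - i - 1, by omega⟩
  unfold racahWeight
  rw [show d + (i + r + 1) - (d + i) = r + 1 by omega,
    show 2 * d + (i + r + 1) - (d + i) = d + r + 1 by omega,
    show d + (i + r + 1) + (d + i) - (2 * d + (i + r + 1)) = i by omega,
    show 2 * d + (i + r + 1) + (d + i) - (d + (i + r + 1)) = 2 * d + i by omega,
    show d + (i + r + 1) - (d + i + 1) = r by omega,
    show 2 * d + (i + r + 1) - (d + i + 1) = d + r by omega,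
    show d + (i + r + 1) + (d + i + 1) - (2 * d + (i + r + 1)) = i + 1 by omega,
    show 2 * d + (i + r + 1) + (d + i + 1) - (d + (i + r + 1)) = 2 * d + i + 1 by omega,
    show d + (i + r + 1) + (d + i + 1) + 1 = (d + (i + r + 1) + (d + i) + 1) + 1 by ring,
    show 2 * d + (i + r + 1) + (d + i + 1) + 1 = (2 * d + (i + r + 1) + (d + i) + 1) + 1 by ring,
    Nat.factorial_succ r, Nat.factorial_succ (d + r), Nat.factorial_succ i,
    Nat.factorial_succ (2 * d + i), Nat.factorial_succ (d + i),
    Nat.factorial_succ (d + (i + r + 1) + (d + i) + 1),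
    Nat.factorial_succ (2 * d + (i + r + 1) + (d + i) + 1)]
  have h1 : ((d + (i + r + 1) + (d + i) + 1)! : ℝ) ≠ 0 := by positivity
  have h2 : ((2 * d + (i + r + 1) + (d + i) + 1)! : ℝ) ≠ 0 := by positivity
  generalize ((d + (i + r + 1) + (d + i) + 1)! : ℕ) = A at *
  generalize ((2 * d + (i + r + 1) + (d + i) + 1)! : ℕ) = B at *
  push_cast
  have h3 : 2 * ((d : ℝ) + i) + 1 ≠ 0 := by positivity
  have h4 : 2 * ((d : ℝ) + i + 1) + 1 ≠ 0 := by positivity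
  have h5 : ((d : ℝ) + i + 1) ≠ 0 := by positivity
  have h6 : ((d : ℝ) + (i + r + 1) + (d + i) + 1 + 1) ≠ 0 := by positivity
  have h7 : (2 * (d : ℝ) + (i + r + 1) + (d + i) + 1 + 1) ≠ 0 := by positivity
  field_simp
  ring

/-- At the largest `j`, only `t = N + M` contributes. -/
lemma racahFun_top (d L i : ℕ) (hi : i ≤ L) :
    racahFun (d + L) (2 * d + L) (d + L) (d + i) =
      (-1) ^ d * ((3 * d + 2 * L + 1)! : ℝ) * ((d ! : ℕ) : ℝ)⁻¹ * invFact (L - i) *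
        (((d + L - i)! : ℕ) : ℝ)⁻¹ * (((d + i)! : ℕ) : ℝ)⁻¹ * invFact i := by
  rw [racahFun_eq_racahTerm (3 * d + 2 * L) fun t ht => by push_cast; omega, racahTerm]
  rw [invFact_eq (m := (3 * d + 2 * L : ℕ) - (d + L : ℕ) - (d + L)) (r := d) (by push_cast; ring),
    show (((3 * d + 2 * L : ℕ) : ℤ) - (2 * d + L : ℕ) - (d + i)) = L - i by push_cast; ring,
    invFact_eq (m := (3 * d + 2 * L : ℕ) - (d + L : ℕ) - (d + i)) (r := d + L - i)
      (by omega),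
    invFact_eq (m := (3 * d + 2 * L : ℕ) - (2 * d + L : ℕ) - (d + L)) (r := 0) (by push_cast; ring),
    invFact_eq (m := (d + L : ℕ) + (2 * d + L : ℕ) - (3 * d + 2 * L : ℕ)) (r := 0)
      (by push_cast; ring),
    invFact_eq (m := d + L + (d + i) + (2 * d + L : ℕ) - (3 * d + 2 * L : ℕ)) (r := d + i)
      (by push_cast; ring),
    show ((d : ℤ) + L + (d + i) + (d + L : ℕ) - (3 * d + 2 * L : ℕ)) = i by push_cast; ring]
  have hs : (-1 : ℝ) ^ (3 * d + 2 * L) = (-1) ^ d := by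
    rw [show 3 * d + 2 * L = d + 2 * (d + L) by ring, pow_add, pow_mul]
    simp
  rw [hs]
  simp

/-- At the smallest `k`, only `t = M + j` contributes. -/
lemma racahFun_bot (d L i : ℕ) :
    racahFun (d + L) (2 * d + L) (d + i) d =
      (-1) ^ (d + L + i) * ((3 * d + L + i + 1)! : ℝ) * ((d ! : ℕ) : ℝ)⁻¹ * invFact i *
        (((d + i)! : ℕ) : ℝ)⁻¹ * invFact (L - i) * ((d ! : ℕ) : ℝ)⁻¹ := by
  rw [racahFun_eq_racahTerm (3 * d + L + i) fun t ht => by push_cast; omega, racahTerm]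
  rw [invFact_eq (m := (3 * d + L + i : ℕ) - (d + L : ℕ) - (d + i)) (r := d) (by push_cast; ring),
    show (((3 * d + L + i : ℕ) : ℤ) - (2 * d + L : ℕ) - d) = i by push_cast; ring,
    invFact_eq (m := (3 * d + L + i : ℕ) - (d + L : ℕ) - d) (r := d + i) (by push_cast; ring),
    invFact_eq (m := (3 * d + L + i : ℕ) - (2 * d + L : ℕ) - (d + i)) (r := 0) (by push_cast; ring),
    show (((d + L : ℕ) : ℤ) + (2 * d + L : ℕ) - (3 * d + L + i : ℕ)) = L - i by push_cast; ring,
    invFact_eq (m := d + i + d + (2 * d + L : ℕ) - (3 * d + L + i : ℕ)) (r := d)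
      (by push_cast; ring),
    invFact_eq (m := d + i + d + (d + L : ℕ) - (3 * d + L + i : ℕ)) (r := 0)
      (by push_cast; ring)]
  have hs : (-1 : ℝ) ^ (3 * d + L + i) = (-1) ^ (d + L + i) := by
    rw [show 3 * d + L + i = d + L + i + 2 * d by ring, pow_add _ _ (2 * d), pow_mul]
    simp
  rw [hs]
  simp

/-- The sum rule at the corner where both factors reduce to single terms. -/
lemma racahFun_sum_rule_corner (d L : ℕ) :
    ∑ i ∈ Finset.range (L + 1), (-1 : ℝ) ^ (d + i) * racahWeight (d + L) (2 * d + L) (d + i) *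
        racahFun (d + L) (2 * d + L) (d + L) (d + i) * racahFun (d + L) (2 * d + L) (d + i) d
      = (-1) ^ L * racahFun (d + L) (2 * d + L) (d + L) d := by
  have htop := racahFun_top d L 0 (Nat.zero_le L)
  simp only [Nat.cast_zero, add_zero, sub_zero, tsub_zero, invFact_eq (m := 0) (r := 0) rfl] at htop
  rw [htop]
  have hsum := sum_wellPoised d L
  have hd : ((d ! : ℕ) : ℝ) ≠ 0 := by positivity
  have : ∀ i ∈ Finset.range (L + 1),
      (-1 : ℝ) ^ (d + i) * racahWeight (d + L) (2 * d + L) (d + i) *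
        racahFun (d + L) (2 * d + L) (d + L) (d + i) * racahFun (d + L) (2 * d + L) (d + i) d
      = ((-1) ^ (d + L) * ((3 * d + 2 * L + 1)! : ℝ) * ((d ! : ℕ) : ℝ)⁻¹ ^ 3) *
        ((2 * d + 2 * i + 1 : ℝ) * ((2 * d + i)! : ℝ) *
      invFact (2 * d + L + i + 1) * invFact i * invFact (L - i)) := by
    intro i hi
    obtain ⟨r, rfl⟩ : ∃ r, L = i + r := ⟨L - i, by have := Finset.mem_range.1 hi; omega⟩
    rw [racahFun_top d _ i (by omega), racahFun_bot d _ i]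
    rw [invFact_eq (m := ((i + r : ℕ) : ℤ) - i) (r := r) (by push_cast; ring), invFact_natCast,
      invFact_eq (m := 2 * d + (i + r : ℕ) + i + 1) (r := 2 * d + (i + r) + i + 1)
        (by push_cast; ring)]
    unfold racahWeight
    rw [show d + (i + r) - (d + i) = r by omega,
      show 2 * d + (i + r) - (d + i) = d + r by omega,
      show d + (i + r) - i = d + r by omega,
      show d + (i + r) + (d + i) - (2 * d + (i + r)) = i by omega,
      show 2 * d + (i + r) + (d + i) - (d + (i + r)) = 2 * d + i by omega,
      show d + (i + r) + (d + i) + 1 = 2 * d + (i + r) + i + 1 by ring,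
      show 2 * d + (i + r) + (d + i) + 1 = 3 * d + (i + r) + i + 1 by ring]
    have hs : (-1 : ℝ) ^ (d + i) * (-1) ^ d * (-1) ^ (d + (i + r) + i) = (-1) ^ (d + (i + r)) := by
      rw [← pow_add, ← pow_add,
        show d + i + d + (d + (i + r) + i) = d + (i + r) + 2 * (d + i) by ring, pow_add, pow_mul]
      simp
    rw [← hs]
    have h1 : (i ! : ℝ) ≠ 0 := by positivity
    have h2 : (r ! : ℝ) ≠ 0 := by positivity
    have h3 : ((d + i)! : ℝ) ≠ 0 := by positivity
    have h4 : ((d + r)! : ℝ) ≠ 0 := by positivity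
    have h5 : ((2 * d + (i + r) + i + 1)! : ℝ) ≠ 0 := by positivity
    have h6 : ((3 * d + (i + r) + i + 1)! : ℝ) ≠ 0 := by positivity
    push_cast
    field_simp
  rw [Finset.sum_congr rfl this, ← Finset.mul_sum, hsum,
    invFact_eq (m := d + L) (r := d + L) (by push_cast; ring)]
  rw [pow_add]
  simp
  field_simp

/-! ### Racah's sum rule -/

/-- The sum rule for `N ≤ M`, with `N = d + L` and `M = 2 d + L`. Both sides solve the same
three-term recurrence in `j` and agree at the corner `(L, 0)`. -/
lemma racahFun_sum_rule_of_le (d L j k : ℕ) (hj : j ≤ L) (hk : k ≤ L) :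
    ∑ i ∈ Finset.range (L + 1), (-1 : ℝ) ^ (d + i) * racahWeight (d + L) (2 * d + L) (d + i) *
        racahFun (d + L) (2 * d + L) (d + j) (d + i) * racahFun (d + L) (2 * d + L) (d + i) (d + k)
      = (-1) ^ (j + k) * racahFun (d + L) (2 * d + L) (d + j) (d + k) := by
  let R : ℤ → ℤ → ℝ := fun x y => racahFun (d + L) (2 * d + L) (d + x) (d + y)
  let σ : ℤ → ℝ := fun x => (-1) ^ (d + x)
  let τ : ℤ → ℝ := fun x => (-1) ^ x
  let G : ℤ → ℝ := fun x => racahWeight (d + L) (2 * d + L) (d + x.toNat)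
  let a : ℤ → ℝ := fun x => (d + x + 1) * ((d + x + 1) ^ 2 - d ^ 2) / (2 * (2 * (d + x) + 1))
  let b : ℤ → ℝ := fun x => ((d + L + 1) ^ 2 - (d + x) ^ 2) * ((2 * d + L + 1) ^ 2 - (d + x) ^ 2) /
    (2 * (d + x) * (2 * (d + x) + 1))
  let C : ℝ := (d + L) ^ 2 + (2 * d + L) ^ 2 - (d + L) * (2 * d + L) + (d + L) + (2 * d + L)
  let lam : ℤ → ℝ := fun x => (d + x) * (d + x + 1)
  let e : ℤ → ℝ := fun x => (C - lam x) / 2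
  let X : ℤ → ℤ → ℝ := fun x y =>
    ∑ i ∈ Finset.range (L + 1), σ i * G i * R x i * R i y
  have hrec : ∀ x y : ℤ, 0 ≤ x → x ≤ L → 0 ≤ y → y ≤ L →
      a x * R (x + 1) y + e x * R x y + b x * R (x - 1) y = lam y * R x y := by
    intro x y hx _ hy _
    have h := racahFun_recurrence (d + L) (2 * d + L) (d + x) (d + y) (by omega) (by omega)
      (by omega)
    push_cast at h
    simp only [a, b, e, C, lam, R]
    rw [← add_assoc, ← add_sub_assoc]
    rw [show ((d : ℝ) + L - (2 * d + L)) ^ 2 = d ^ 2 by ring] at h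
    exact h
  have hC : ∀ x, lam x + 2 * e x = C := fun x => by simp only [e]; ring
  have hsymm : ∀ x y, R x y = R y x := fun x y => racahFun_comm _ _ _ _
  have h0 : ∀ y : ℤ, 0 ≤ y → y ≤ L → R (-1) y = 0 := fun y hy hyL =>
    Finset.sum_eq_zero fun t _ => racahTerm_eq_zero (by push_cast; omega)
  have hL : ∀ y : ℤ, 0 ≤ y → y ≤ L → R (L + 1) y = 0 := fun y hy hyL =>
    Finset.sum_eq_zero fun t _ => racahTerm_eq_zero (by push_cast; omega)
  have hbal : ∀ x : ℤ, 0 ≤ x → x < L → G x * a x = G (x + 1) * b (x + 1) := by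
    intro x hx hxL
    lift x to ℕ using hx
    have h := racahWeight_balance d L x (by omega)
    simp only [G, a, b, Int.toNat_natCast, show ((x : ℤ) + 1).toNat = x + 1 by omega]
    push_cast
    rw [← add_assoc (d : ℝ), ← add_assoc d]
    exact h
  have hσ : ∀ x, σ (x + 1) = -σ x := fun x => by
    simp only [σ]
    rw [← add_assoc, zpow_add_one₀ (by norm_num)]
    ring
  have hτ : ∀ x, τ (x + 1) = -τ x := fun x => by
    simp only [τ]
    rw [zpow_add_one₀ (by norm_num)]
    ring
  have hτ' : ∀ x, τ (x - 1) = -τ x := fun x => by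
    have := hτ (x - 1)
    rw [sub_add_cancel] at this
    linarith
  have hX := recurrence_conj hrec hC hsymm h0 hL hbal hσ
  have hZ : X j k - τ j * τ k * R j k = 0 := by
    refine eq_zero_of_recurrence (L := L) (a := fun x => -a x) (b := fun x => -b x) (e := e)
      (lam := lam) (Z := fun x y => X x y - τ x * τ y * R x y) ?_ ?_ ?_ ?_ ?_ ?_ ?_ j k
      (by omega) (by omega) (by omega) (by omega)
    · intro x y hx hxL hy hyL
      have h1 := hX x y hx hxL hy hyL
      have h2 := hrec x y hx hxL hy hyL
      simp only [hτ, hτ']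
      simp only [X]
      linear_combination h1 - τ x * τ y * h2
    · intro x y
      have : X x y = X y x := Finset.sum_congr rfl fun i _ => by
        rw [hsymm x i, hsymm i y]
        ring
      rw [this, hsymm x y]
      ring
    · intro y hy hyL
      have : X (-1) y = 0 := Finset.sum_eq_zero fun i hi => by
        have := Finset.mem_range.1 hi
        rw [h0 i (by omega) (by omega)]
        ring
      simp only [this, h0 y hy hyL]
      ring
    · intro y hy hyL
      have : X (L + 1) y = 0 := Finset.sum_eq_zero fun i hi => by
        have := Finset.mem_range.1 hi
        rw [hL i (by omega) (by omega)]
        ring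
      simp only [this, hL y hy hyL]
      ring
    · intro x hx hxL
      lift x to ℕ using hx
      simp only [a, ne_eq, neg_eq_zero, Int.cast_natCast]
      have h1 : (0 : ℝ) < (d + x + 1) ^ 2 - d ^ 2 := by
        have h2 : (0 : ℝ) < (x + 1) * (2 * d + x + 1) := by positivity
        linarith
      positivity
    · intro x hx hxL
      simp only [b, ne_eq, neg_eq_zero]
      have hx' : (0 : ℝ) < x := by exact_mod_cast hx
      have hxL' : (x : ℝ) ≤ L := by exact_mod_cast hxL
      have h1 : (0 : ℝ) < (d + L + 1) ^ 2 - (d + x) ^ 2 := by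
        have : (0 : ℝ) < (L - x + 1) * (2 * d + L + x + 1) :=
          mul_pos (by linarith) (by positivity)
        linarith
      have h2 : (0 : ℝ) < (2 * d + L + 1) ^ 2 - (d + x) ^ 2 := by
        have : (0 : ℝ) < (d + (L - x) + 1) * (3 * d + L + x + 1) :=
          mul_pos (by have : (0 : ℝ) ≤ d := by positivity
                      linarith) (by positivity)
        linarith
      positivity
    · have h := racahFun_sum_rule_corner d L
      simp only [X, σ, G, R, τ, Int.toNat_natCast, add_zero, zpow_zero, mul_one]
      rw [sub_eq_zero]
      exact_mod_cast h
  have := sub_eq_zero.1 hZ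
  simp only [X, σ, G, R, τ, Int.toNat_natCast] at this
  rw [pow_add]
  exact_mod_cast this

/-- Racah's sum rule for the `6j`-symbols `{N/2, N/2, j; N/2, M - N/2, k}`, in the normalization of
`racahFun`. -/
theorem racahFun_sum_rule (N M j k : ℕ) (h₁ : N ≤ 2 * M) (h₂ : M ≤ 2 * N)
    (hj : j ∈ Finset.Icc (N - M + (M - N)) (min N M))
    (hk : k ∈ Finset.Icc (N - M + (M - N)) (min N M)) :
    ∑ x ∈ Finset.Icc (N - M + (M - N)) (min N M), (-1 : ℝ) ^ x * racahWeight N M x *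
        racahFun N M j x * racahFun N M x k
      = (-1) ^ (j + k) * racahFun N M j k := by
  wlog hle : N ≤ M generalizing N M
  · have h := this M N h₂ h₁ (by rwa [add_comm, min_comm]) (by rwa [add_comm, min_comm]) (by omega)
    rw [add_comm (M - N), min_comm] at h
    simpa only [racahWeight_swap M N, racahFun_swap M N] using h
  obtain ⟨d, rfl⟩ : ∃ d, M = N + d := ⟨M - N, by omega⟩
  obtain ⟨L, rfl⟩ : ∃ L, N = d + L := ⟨N - d, by omega⟩
  rw [show d + L + d = 2 * d + L by ring] at *
  rw [show d + L - (2 * d + L) + (2 * d + L - (d + L)) = d by omega,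
    show min (d + L) (2 * d + L) = d + L by omega] at *
  rw [Finset.mem_Icc] at hj hk
  obtain ⟨j, rfl⟩ := Nat.exists_eq_add_of_le hj.1
  obtain ⟨k, rfl⟩ := Nat.exists_eq_add_of_le hk.1
  have h := racahFun_sum_rule_of_le d L j k (by omega) (by omega)
  rw [← Finset.Ico_add_one_right_eq_Icc, Finset.sum_Ico_eq_sum_range,
    show d + L + 1 - d = L + 1 by omega]
  rw [show d + j + (d + k) = j + k + 2 * d by ring, pow_add _ _ (2 * d), pow_mul]
  push_cast
  simpa using h

/-! ### The matrices in terms of the normalized `6j`-symbols -/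

lemma racahSum_eq_racahFun (N M j k : ℕ) :
    racahSum (N + j) (M + k) (N + k) (M + j) (N + M) (j + k + M) (j + k + N)
      = racahFun N M j k := by
  unfold racahSum racahFun
  refine (Finset.sum_congr rfl fun t ht => ?_).trans
    (Finset.sum_subset (f := racahTerm N M j k) (fun t ht => ?_) fun t _ ht => ?_)
  · simp only [Finset.mem_Icc, max_le_iff, le_min_iff] at ht
    rw [racahTerm, invFact_eq (m := t - N - j) (r := t - (N + j)) (by omega),
      invFact_eq (m := t - M - k) (r := t - (M + k)) (by omega),
      invFact_eq (m := t - N - k) (r := t - (N + k)) (by omega),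
      invFact_eq (m := t - M - j) (r := t - (M + j)) (by omega),
      invFact_eq (m := N + M - t) (r := N + M - t) (by omega),
      invFact_eq (m := j + k + M - t) (r := j + k + M - t) (by omega),
      invFact_eq (m := j + k + N - t) (r := j + k + N - t) (by omega)]
    push_cast
    simp only [div_eq_mul_inv, mul_inv, mul_assoc]
  · simp only [Finset.mem_Icc, max_le_iff, le_min_iff] at ht
    exact Finset.mem_range.2 (by omega)
  · refine racahTerm_eq_zero fun h => ht ?_
    simp only [Finset.mem_Icc, max_le_iff, le_min_iff]
    omega

/-- The factor of a `6j`-symbol `{N/2, N/2, j; N/2, M - N/2, k}` that depends on `j` alone, times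
`√(2 j + 1)`. -/
noncomputable def sixJFactor (N M j : ℕ) : ℝ :=
  √(2 * j + 1) * triangleCoeff N N (2 * j) * triangleCoeff N (2 * M - N) (2 * j)

lemma sixJFactor_mul_self (N M j : ℕ) (h₁ : N ≤ 2 * M)
    (hj : j ∈ Finset.Icc (N - M + (M - N)) (min N M)) :
    sixJFactor N M j * sixJFactor N M j = racahWeight N M j := by
  rw [Finset.mem_Icc, le_min_iff] at hj
  unfold sixJFactor triangleCoeff racahWeight
  rw [show (N + N - 2 * j) / 2 = N - j by omega, show (N + 2 * j - N) / 2 = j by omega,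
    show (N + N + 2 * j) / 2 + 1 = N + j + 1 by omega,
    show (N + (2 * M - N) - 2 * j) / 2 = M - j by omega,
    show (N + 2 * j - (2 * M - N)) / 2 = N + j - M by omega,
    show (2 * M - N + 2 * j - N) / 2 = M + j - N by omega,
    show (N + (2 * M - N) + 2 * j) / 2 + 1 = M + j + 1 by omega,
    mul_mul_mul_comm, mul_mul_mul_comm (√_), Real.mul_self_sqrt (by positivity),
    Real.mul_self_sqrt (by positivity), Real.mul_self_sqrt (by positivity)]

/-- The four triangle coefficients of the `6j`-symbol regroup into a factor depending on `j` and the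
same factor depending on `k`. -/
lemma sqrt_mul_sixJ (N M j k : ℕ) (h₁ : N ≤ 2 * M)
    (hj : j ∈ Finset.Icc (N - M + (M - N)) (min N M))
    (hk : k ∈ Finset.Icc (N - M + (M - N)) (min N M)) :
    √((2 * j + 1) * (2 * k + 1)) * sixJ N N (2 * j) N (2 * M - N) (2 * k)
      = sixJFactor N M j * sixJFactor N M k * racahFun N M j k := by
  rw [Finset.mem_Icc, le_min_iff] at hj hk
  have htri : IsTriad N N (2 * j) ∧ IsTriad N (2 * M - N) (2 * k) ∧ IsTriad N N (2 * k) ∧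
      IsTriad N (2 * M - N) (2 * j) := by
    simp only [IsTriad, Nat.even_iff]
    omega
  rw [sixJ, if_pos htri, show (N + N + 2 * j) / 2 = N + j by omega,
    show (N + (2 * M - N) + 2 * k) / 2 = M + k by omega,
    show (N + N + 2 * k) / 2 = N + k by omega,
    show (N + (2 * M - N) + 2 * j) / 2 = M + j by omega,
    show (N + N + N + (2 * M - N)) / 2 = N + M by omega,
    show (N + 2 * j + (2 * M - N) + 2 * k) / 2 = j + k + M by omega,
    show (2 * j + N + 2 * k + N) / 2 = j + k + N by omega,
    racahSum_eq_racahFun, Real.sqrt_mul (by positivity), sixJFactor, sixJFactor]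
  ring

/-- In terms of the spin `j = N - k`, both cases of `levelRange` are the range
`|N - M| ≤ j ≤ min N M` with `M = 2 N - n`; of the two truncated differences one is zero. -/
lemma mem_levelRange {N n k : ℕ} (hn : n ≤ 3 * N / 2) :
    k ∈ levelRange N n ↔
      k ≤ N ∧ N - k ∈ Finset.Icc (N - (2 * N - n) + (2 * N - n - N)) (min N (2 * N - n)) := by
  unfold levelRange
  split_ifs with h <;> simp only [Finset.mem_Icc, le_min_iff] <;> omega

lemma matA_apply {N n : ℕ} (hn : n ≤ 3 * N / 2) (k l : levelRange N n) :
    matA N n k l = (-1) ^ ((N : ℤ) - n) * (sixJFactor N (2 * N - n) (N - k) *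
      sixJFactor N (2 * N - n) (N - l) * racahFun N (2 * N - n) (N - k : ℕ) (N - l : ℕ)) := by
  obtain ⟨hk, hk'⟩ := (mem_levelRange hn).1 k.2
  obtain ⟨hl, hl'⟩ := (mem_levelRange hn).1 l.2
  rw [← sqrt_mul_sixJ N (2 * N - n) _ _ (by omega) hk' hl', matA, Matrix.of_apply,
    show 2 * (2 * N - n) - N = 3 * N - 2 * n by omega, Nat.cast_sub hk, Nat.cast_sub hl, mul_assoc]
  ring_nf

end SpinChain


/-- For every spin `s = twoS / 2`, a positive integer or half-integer, and every level
`n = 0, …, [3s]` (the natural number `3 * twoS / 2` is the integer part of `3s`). -/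
theorem lemma3 (twoS : ℕ) (hs : 0 < twoS) (n : ℕ) (hn : n ≤ 3 * twoS / 2) :
    SpinChain.matA twoS n * SpinChain.matD₀ twoS n * SpinChain.matA twoS n =
      (-1 : ℝ) ^ n •
        (SpinChain.matD₀ twoS n * SpinChain.matA twoS n * SpinChain.matD₀ twoS n) := by
  open SpinChain in
  ext k l
  have hk := (mem_levelRange hn).1 k.2
  have hl := (mem_levelRange hn).1 l.2
  rw [Matrix.mul_apply, Matrix.smul_apply]
  simp only [matD₀, Matrix.mul_diagonal, Matrix.diagonal_mul, matA_apply hn]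
  set M := 2 * twoS - n with hM
  have hrule := racahFun_sum_rule twoS M (twoS - k) (twoS - l) (by omega) (by omega) hk.2 hl.2
  have hsum : ∀ f : ℕ → ℝ, ∑ x : levelRange twoS n, f (twoS - x) =
      ∑ x ∈ Finset.Icc (twoS - M + (M - twoS)) (min twoS M), f x := by
    intro f
    rw [Finset.sum_coe_sort (levelRange twoS n) fun x => f (twoS - x)]
    refine Finset.sum_nbij' (fun x => twoS - x) (fun x => twoS - x)
      (fun x hx => ((mem_levelRange hn).1 hx).2) (fun x hx => (mem_levelRange hn).2 ?_)
      (fun x hx => ?_) (fun x hx => ?_) (fun _ _ => rfl)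
    · have := Finset.mem_Icc.1 hx
      rw [show twoS - (twoS - x) = x by omega]
      exact ⟨by omega, hx⟩
    · have := (mem_levelRange hn).1 hx
      omega
    · have := Finset.mem_Icc.1 hx
      omega
  -- the signs, rewritten in terms of `twoS - x`
  have sgn : ∀ x : ℕ, x ≤ twoS → (-1 : ℝ) ^ x = (-1) ^ twoS * (-1) ^ (twoS - x) := by
    intro x hx
    rw [← pow_add, show twoS + (twoS - x) = x + 2 * (twoS - x) by omega, pow_add, pow_mul]
    simp
  have hε : (-1 : ℝ) ^ ((twoS : ℤ) - n) = (-1) ^ twoS * (-1) ^ n := by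
    rw [zpow_sub₀ (by norm_num), zpow_natCast, zpow_natCast, div_eq_mul_inv, ← inv_pow]
    norm_num
  have hsq : ∀ m : ℕ, (-1 : ℝ) ^ m * (-1) ^ m = 1 := fun m => by
    rw [← mul_pow]
    norm_num
  have hterm : ∀ x : levelRange twoS n,
      (-1 : ℝ) ^ ((twoS : ℤ) - n) * (sixJFactor twoS M (twoS - k) * sixJFactor twoS M (twoS - x) *
        racahFun twoS M (twoS - k : ℕ) (twoS - x : ℕ)) * (-1) ^ (x : ℕ) *
      ((-1 : ℝ) ^ ((twoS : ℤ) - n) * (sixJFactor twoS M (twoS - x) * sixJFactor twoS M (twoS - l) *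
        racahFun twoS M (twoS - x : ℕ) (twoS - l : ℕ))) =
      (-1) ^ twoS * sixJFactor twoS M (twoS - k) * sixJFactor twoS M (twoS - l) *
        ((-1 : ℝ) ^ (twoS - x) * racahWeight twoS M (twoS - x) *
        racahFun twoS M (twoS - k : ℕ) (twoS - x : ℕ) *
        racahFun twoS M (twoS - x : ℕ) (twoS - l : ℕ)) := by
    intro x
    have hx := (mem_levelRange hn).1 x.2
    rw [← sixJFactor_mul_self twoS M _ (by omega) hx.2, sgn x hx.1, hε]
    linear_combination ((-1) ^ twoS * sixJFactor twoS M (twoS - k) * sixJFactor twoS M (twoS - l) *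
        ((-1 : ℝ) ^ (twoS - x) * (sixJFactor twoS M (twoS - x) * sixJFactor twoS M (twoS - x)) *
        racahFun twoS M (twoS - k : ℕ) (twoS - x : ℕ) *
        racahFun twoS M (twoS - x : ℕ) (twoS - l : ℕ))) *
        ((-1 : ℝ) ^ n * (-1) ^ n * hsq twoS + hsq n)
  rw [Finset.sum_congr rfl fun x _ => hterm x, ← Finset.mul_sum,
    hsum fun x => (-1 : ℝ) ^ x * racahWeight twoS M x *
        racahFun twoS M (twoS - k : ℕ) x * racahFun twoS M x (twoS - l : ℕ), hrule, hε,
    sgn k hk.1, sgn l hl.1, smul_eq_mul, pow_add]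
  linear_combination (-(-1) ^ twoS * sixJFactor twoS M (twoS - k) * sixJFactor twoS M (twoS - l) *
    (-1 : ℝ) ^ (twoS - k : ℕ) * (-1) ^ (twoS - l : ℕ) *
    racahFun twoS M (twoS - k : ℕ) (twoS - l : ℕ)) *
    ((-1 : ℝ) ^ n * (-1) ^ n * hsq twoS + hsq n)
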